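/- **Setting.** A hypergraph with $n$ parties consists of a vertex set $V$, a set $E$ of hyperedges (subsets of $V$ with at least two elements), weights $w:E\to\mathbb R_{\ge 0}$, a set $\partial V\subseteq V$ of boundary vertices, and a colouring $b:\partial V\to\{1,\dots,n+1\}$; the colour $n+1$ is the purifier. Its rank is the largest cardinality of a hyperedge of non-zero weight. For $W\subseteq V$ let $|C(W)|$ be the sum of $w(e)$ over all $e\in E$ that meet both $W$ and $V\setminus W$. For $I\subseteq\{1,\dots,n\}$ the discrete entropy is $$S(I)=\min\{|C(W)| : W\cap\partial V=b^{-1}(I)\}$$ (an infimum in $[0,\infty]$ if $V$ is infinite). A vector $Q=(Q_I)$ of integers indexed by the non-empty $I\subseteq\{1,\dots,n\}$ encodes the inequality $\sum_I Q_I S(I)\ge 0$, that is, $$\sum_{Q_I>0}Q_I\,S(I)\ \ge\ \sum_{Q_I<0}|Q_I|\,S(I).$$ Put $S(J)=S(\{1,\dots,n+1\}\setminus J)$ for $J\ni n+1$. Two inequalities are equivalent if a permutation of $\{1,\dots,n+1\}$ turns one into a positive multiple of the other. A contraction map of rank $k\ge2$ for $Q$ is a map $f:\{0,1\}^{L}\to\{0,1\}^{\beta_T}$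 as follows. Here $L$ is the number of $I$ with $Q_I>0$, which index the bits of the domain and have weights $\alpha_I=Q_I$; and $\beta_T=\sum_{Q_I<0}|Q_I|$, where each $I$ with $Q_I<0$ indexes $|Q_I|$ bits of the target, of weight $1$. For each colour $c\in\{1,\dots,n+1\}$, $f$ sends the bit string $(\mathbf 1[c\in I])_I$ of the domain to the corresponding bit string of the target; and for all $x^1,\dots,x^k\in\{0,1\}^L$ the total weight of the positions at which $f(x^1),\dots,f(x^k)$ do not all agree is at most the total weight of the positions at which $x^1,\dots,x^k$ do not all agree. **The inequalities.** Let $n=5$ with parties $A,B,C,D,E$. Write $I(X:Y|Z)=S(XZ)+S(YZ)-S(XYZ)-S(Z)$ with $S(\emptyset)=0$, and $$\mathrm{Ing}(X,Y;Z,W|T)=I(X:Y|ZT)+I(X:Y|WT)+I(Z:W|T)-I(X:Y|T).$$ The 31 five-party quantum linear rank inequalities are represented by the seven uplifted instances of subadditivity, strong subadditivity and the Ingleton inequality, $$I(A:B)\ge0,\quad I(A:B|C)\ge0,\quad I(A:B|CD)\ge0,$$ $$\mathrm{Ing}(A,B;C,D)\ge0,\quad \mathrm{Ing}(AE,B;C,D)\ge0,\quad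 \mathrm{Ing}(A,B;CE,D)\ge0,\quad \mathrm{Ing}(A,B;C,D|E)\ge0,$$ together with the following 24 vectors, whose entries are in the order $A,B,C,D,E,AB,AC,AD,AE,BC,\dots,DE,ABC,\dots,CDE,ABCD,\dots,BCDE,ABCDE$: $$\begin{aligned} Q_{1}&=(0,-1,0,-1,0,1,-1,1,0,1,1,0,0,0,0,0,-1,0,0,1,0,0,-1,0,1,0,0,0,-1,0,0),\\ Q_{2}&=(0,-1,0,0,-1,1,-1,0,0,0,0,1,0,1,0,0,0,0,1,0,1,1,0,-1,0,-1,0,0,-1,0,0),\\ Q_{3}&=(0,-1,0,0,0,1,-1,0,0,1,0,0,0,0,-1,0,0,0,1,0,1,-1,0,1,1,0,0,-1,-1,0,0),\\ Q_{4}&=(-2,-2,0,0,0,2,1,1,1,1,1,1,0,0,0,-1,-1,-1,0,0,0,0,0,0,-1,0,0,0,0,0,0),\\ Q_{5}&=(-1,-2,0,0,0,2,-1,1,1,1,1,1,0,0,-1,0,-1,-1,0,0,0,0,0,0,1,0,0,0,0,-1,0),\\ Q_{6}&=(-1,0,-1,-1,0,1,1,1,1,1,0,-1,1,0,1,-1,0,0,-1,0,-1,0,0,0,0,0,0,0,0,0,0),\\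 Q_{7}&=(0,-1,-1,-1,0,1,1,1,-1,1,1,0,0,1,1,-1,-1,0,0,0,0,0,0,0,-1,0,0,0,0,0,0),\\ Q_{8}&=(0,0,0,-1,0,0,0,1,0,-1,0,-1,0,0,0,1,-1,1,0,-1,0,1,2,1,1,0,-1,0,0,-2,0),\\ Q_{9}&=(0,0,0,0,0,0,0,-1,0,-1,0,0,0,-1,0,1,1,0,0,1,1,1,1,-1,1,-1,-1,0,-1,0,0),\\ Q_{10}&=(0,0,0,0,0,0,0,0,-1,-1,-1,0,-1,0,0,1,1,0,1,0,0,2,1,1,1,-2,0,0,0,-2,0),\\ Q_{11}&=(0,0,0,0,0,0,0,0,0,-1,-1,0,0,0,-1,1,1,0,0,-1,1,1,1,1,1,-1,0,-1,0,-1,0),\\ Q_{12}&=(-2,0,0,0,-2,2,1,1,1,-1,-1,2,0,1,1,0,0,-2,-1,0,0,1,0,0,0,0,0,0,0,-1,0),\\ Q_{13}&=(-1,-2,0,0,0,2,1,1,-1,1,1,1,-1,0,0,-1,-1,0,0,0,1,0,0,-1,1,0,0,0,-1,0,0),\\ Q_{14}&=(-1,0,-1,0,0,1,1,1,0,0,-1,0,1,0,-1,0,0,0,-1,-1,1,0,1,1,1,0,0,-1,0,-1,0),\\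 Q_{15}&=(-1,0,0,-2,-1,1,1,2,-1,-1,1,1,1,1,2,0,-1,0,-1,0,0,0,0,-1,-1,0,0,0,0,0,0),\\ Q_{16}&=(0,-1,0,-1,0,1,-1,1,0,1,0,0,1,-1,0,0,0,0,0,1,-1,-1,1,1,1,0,-1,0,0,-1,0),\\ Q_{17}&=(0,0,-1,0,0,0,0,0,-1,0,-2,0,0,1,0,1,1,1,1,0,1,2,-1,2,-1,-2,0,-2,0,0,0),\\ Q_{18}&=(0,0,0,-1,-1,0,-1,1,1,0,0,-1,0,1,1,1,-1,1,0,0,-1,1,0,1,0,0,-1,0,0,-1,0),\\ Q_{19}&=(0,0,0,0,-1,0,0,-1,1,-1,0,0,-1,0,1,1,1,0,1,-1,0,2,1,-1,1,-2,0,0,0,-1,0),\\ Q_{20}&=(0,0,0,0,0,0,-1,0,-1,-1,0,-1,0,0,0,2,-1,2,1,1,1,1,1,1,-1,-1,-2,-1,0,0,0),\\ Q_{21}&=(-3,0,-1,0,0,2,2,1,2,1,0,-2,-1,1,0,-1,-1,0,0,-1,-1,1,0,2,1,0,0,0,0,-2,0),\\ Q_{22}&=(-2,0,-1,0,0,1,1,2,1,0,-1,0,1,0,-1,0,0,-1,-2,0,0,1,1,1,1,0,0,0,0,-2,0),\\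 Q_{23}&=(-2,0,0,0,0,1,0,1,2,-1,0,-1,-1,0,-1,1,-1,0,1,-2,0,2,2,1,2,-1,0,0,0,-3,0),\\ Q_{24}&=(-2,0,0,0,0,1,1,1,1,0,-1,0,0,-2,0,0,0,0,-1,1,-1,1,1,1,2,0,-1,0,0,-2,0). \end{aligned}$$ **Theorem.** These 31 inequalities are pairwise inequivalent. The following fourteen of them are valid on every five-party hypergraph of finite rank: the seven uplifted ones and $Q_1,Q_2,Q_3,Q_6,Q_7,Q_9,Q_{11}$. Moreover, for each of these fourteen there is one map $f$ that is a contraction map of every rank $k\ge2$ (in particular of every rank up to $\beta_T$). -/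

import Mathlib

open scoped NNReal ENNReal

universe u

/-- A weighted hypergraph on the vertex set `V` with boundary vertices coloured by
`Fin (n + 1)`: the colours `0, …, n - 1` are the `n` parties and the last colour is the purifier.
Hyperedges are sets of at least two vertices.  Vertices outside `boundary` are bulk vertices. -/
structure ColoredHypergraph (n : ℕ) (V : Type u) where
  edges : Set (Set V)
  two_le_encard : ∀ e ∈ edges, 2 ≤ e.encard
  weight : edges → ℝ≥0
  boundary : Set V
  color : boundary → Fin (n + 1)

namespace ColoredHypergraph

variable {n : ℕ} {V : Type u}

/-- The largest cardinality of a hyperedge of non-zero weight. -/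
noncomputable def rank (H : ColoredHypergraph n V) : ℕ∞ :=
  ⨆ (e : H.edges) (_ : H.weight e ≠ 0), (e : Set V).encard

def FiniteRank (H : ColoredHypergraph n V) : Prop := H.rank ≠ ⊤

/-- The hyperedges that meet both `W` and its complement. -/
def cutEdges (H : ColoredHypergraph n V) (W : Set V) : Set H.edges :=
  {e | ((e : Set V) ∩ W).Nonempty ∧ ((e : Set V) ∩ Wᶜ).Nonempty}

/-- The total weight of the cut hyperedges, in `[0, ∞]`. -/
noncomputable def cutWeight (H : ColoredHypergraph n V) (W : Set V) : ℝ≥0∞ :=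
  ∑' e : H.cutEdges W, (H.weight e : ℝ≥0∞)

/-- `W` contains precisely those boundary vertices that are coloured by the parties in `I`. -/
def IsCut (H : ColoredHypergraph n V) (I : Finset (Fin n)) (W : Set V) : Prop :=
  W ∩ H.boundary = Subtype.val '' {v : H.boundary | ∃ i ∈ I, H.color v = i.castSucc}

/-- The discrete entropy of `I`: the minimum cut weight.  It is written as an infimum so that
infinite hypergraphs are covered too; see `exists_minCut` for finite ones. -/
noncomputable def entropy (H : ColoredHypergraph n V) (I : Finset (Fin n)) : ℝ≥0∞ :=
  ⨅ (W : Set V) (_ : H.IsCut I W), H.cutWeight W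

theorem cutWeight_ne_top [Finite V] (H : ColoredHypergraph n V) (W : Set V) :
    H.cutWeight W ≠ ⊤ := by
  have := Fintype.ofFinite (H.cutEdges W)
  rw [cutWeight, tsum_fintype]
  exact ENNReal.sum_ne_top.2 fun e _ => ENNReal.coe_ne_top

theorem exists_isCut (H : ColoredHypergraph n V) (I : Finset (Fin n)) : ∃ W, H.IsCut I W :=
  ⟨Subtype.val '' {v : H.boundary | ∃ i ∈ I, H.color v = i.castSucc},
    Set.inter_eq_left.2 (by rintro _ ⟨v, -, rfl⟩; exact v.2)⟩

/-- On a finite vertex set the infimum is a minimum, and it is finite. -/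
theorem exists_minCut [Finite V] (H : ColoredHypergraph n V) (I : Finset (Fin n)) :
    ∃ W, H.IsCut I W ∧ H.entropy I = H.cutWeight W ∧ H.entropy I ≠ ⊤ := by
  obtain ⟨W, hW, hmin⟩ := Set.exists_min_image {W | H.IsCut I W} H.cutWeight
    (Set.toFinite _) (H.exists_isCut I)
  have h : H.entropy I = H.cutWeight W :=
    le_antisymm (iInf₂_le W hW) (le_iInf₂ fun W' hW' => hmin W' hW')
  exact ⟨W, hW, h, h ▸ H.cutWeight_ne_top W⟩

end ColoredHypergraph

/-- The coefficient vector `Q` of a linear entropy inequality `∑ I, Q I * S I ≥ 0` for `n`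
parties; the coefficient of the empty set is irrelevant and is always `0` below. -/
abbrev EntropyIneq (n : ℕ) : Type := Finset (Fin n) → ℤ

namespace EntropyIneq

variable {n : ℕ}

/-- The inequality `∑ I, Q I * S I ≥ 0` for the entropies of `H`, with the terms of negative
coefficient moved to the other side. -/
def HoldsOn (Q : EntropyIneq n) {V : Type u} (H : ColoredHypergraph n V) : Prop :=
  ∑ I, ((-Q I).toNat : ℝ≥0∞) * H.entropy I ≤ ∑ I, ((Q I).toNat : ℝ≥0∞) * H.entropy I

/-- If all entropies are finite, this is the inequality `0 ≤ ∑ I, Q I * S I` in the reals. -/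
theorem holdsOn_iff (Q : EntropyIneq n) {V : Type u} (H : ColoredHypergraph n V)
    (hH : ∀ I, H.entropy I ≠ ⊤) :
    Q.HoldsOn H ↔ 0 ≤ ∑ I, (Q I : ℝ) * (H.entropy I).toReal := by
  have key : ∀ c : Finset (Fin n) → ℕ, (∑ I, (c I : ℝ≥0∞) * H.entropy I) ≠ ⊤ ∧
      (∑ I, (c I : ℝ≥0∞) * H.entropy I).toReal = ∑ I, (c I : ℝ) * (H.entropy I).toReal := by
    intro c
    have h : ∀ I ∈ Finset.univ, (c I : ℝ≥0∞) * H.entropy I ≠ ⊤ := fun I _ =>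
      ENNReal.mul_ne_top (ENNReal.natCast_ne_top _) (hH I)
    exact ⟨ENNReal.sum_ne_top.2 h, by rw [ENNReal.toReal_sum h]; simp⟩
  rw [HoldsOn, ← ENNReal.toReal_le_toReal (key _).1 (key _).1, (key _).2, (key _).2,
    ← sub_nonneg, ← Finset.sum_sub_distrib]
  have hI : ∀ I, ((Q I).toNat : ℝ) * (H.entropy I).toReal
      - ((-Q I).toNat : ℝ) * (H.entropy I).toReal = (Q I : ℝ) * (H.entropy I).toReal := by
    intro I
    rw [← sub_mul]
    congr 1
    exact_mod_cast Int.toNat_sub_toNat_neg (Q I)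
  simp_rw [hI]

/-! ### Contraction maps -/

/-- The terms of the left-hand side, each occurring once (standard form). -/
abbrev LHS (Q : EntropyIneq n) : Type := {I : Finset (Fin n) // 0 < Q I}

/-- The terms of the right-hand side, each repeated as often as its coefficient says
(expanded form). -/
abbrev RHS (Q : EntropyIneq n) : Type := Σ I : Finset (Fin n), Fin (-Q I).toNat

/-- The weighted indicator function of `k` bit strings: the total weight of the positions at
which the bit strings do not all agree. -/
def weightedIndicator {ι : Type*} [Fintype ι] (α : ι → ℕ) {k : ℕ} (x : Fin k → ι → Bool) : ℕ :=
  ∑ l, α l * (if ∀ i j, x i l = x j l then 0 else 1)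

/-- The indicator of the colour `c` in `I`; it vanishes if `c` is the purifier. -/
def occurrence (c : Fin (n + 1)) (I : Finset (Fin n)) : Bool :=
  decide (c ∈ I.map Fin.castSuccEmb)

/-- `f` contracts the `k`-distances and sends the occurrence vectors of the left-hand side to
those of the right-hand side. -/
structure IsContractionMap (Q : EntropyIneq n) (k : ℕ) (f : (Q.LHS → Bool) → (Q.RHS → Bool)) :
    Prop where
  occurrence_eq : ∀ c : Fin (n + 1),
    f (fun l => occurrence c l.1) = fun r => occurrence c r.1
  contracts : ∀ x : Fin k → Q.LHS → Bool,
    weightedIndicator (fun _ : Q.RHS => 1) (fun i => f (x i)) ≤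
      weightedIndicator (fun l : Q.LHS => (Q l.1).toNat) x

/-! ### Equivalence under the symmetries of the entropy -/

/-- The subset of the `n` parties that has the same entropy as the set `J` of parties of the
purified state: `J` itself if it does not contain the purifier, its complement otherwise. -/
def unpurify (J : Finset (Fin (n + 1))) : Finset (Fin n) :=
  Finset.univ.filter fun i => ¬ (i.castSucc ∈ J ↔ Fin.last n ∈ J)

/-- Two inequalities are equivalent if a permutation of the `n` parties and the purifier turns
one into a positive multiple of the other. -/
def Equivalent (Q Q' : EntropyIneq n) : Prop :=
  ∃ (σ : Equiv.Perm (Fin (n + 1))) (c : ℚ), 0 < c ∧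
    ∀ J : Finset (Fin (n + 1)),
      (Q' (unpurify J) : ℚ) = c * Q (unpurify (J.map σ.toEmbedding))

/-! ### The 31 five-party inequalities -/

/-- The entropy of `I`, as a linear form. -/
def S (I : Finset (Fin n)) : EntropyIneq n := fun J => if J = I ∧ J.Nonempty then 1 else 0

/-- The conditional mutual information `I(X : Y | Z)`, as a linear form. -/
def condMutualInfo (X Y Z : Finset (Fin n)) : EntropyIneq n :=
  S (X ∪ Z) + S (Y ∪ Z) - S (X ∪ Y ∪ Z) - S Z

/-- The Ingleton expression conditioned on `E`:
`I(A : B | C E) + I(A : B | D E) + I(C : D | E) - I(A : B | E)`. -/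
def ingleton (A B C D E : Finset (Fin n)) : EntropyIneq n :=
  condMutualInfo A B (C ∪ E) + condMutualInfo A B (D ∪ E) + condMutualInfo C D E
    - condMutualInfo A B E

/-- The five-party instances of subadditivity, strong subadditivity and the Ingleton
inequality, one for each orbit of the symmetries. -/
def uplifted : Fin 7 → EntropyIneq 5 :=
  ![condMutualInfo {0} {1} ∅,
    condMutualInfo {0} {1} {2},
    condMutualInfo {0} {1} {2, 3},
    ingleton {0} {1} {2} {3} ∅,
    ingleton {0, 4} {1} {2} {3} ∅,
    ingleton {0} {1} {2, 4} {3} ∅,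
    ingleton {0} {1} {2} {3} {4}]

/-- The non-empty subsets of the five parties, by cardinality and then lexicographically. -/
def subsets : List (Finset (Fin 5)) :=
  [{0}, {1}, {2}, {3}, {4},
   {0, 1}, {0, 2}, {0, 3}, {0, 4}, {1, 2}, {1, 3}, {1, 4}, {2, 3}, {2, 4}, {3, 4},
   {0, 1, 2}, {0, 1, 3}, {0, 1, 4}, {0, 2, 3}, {0, 2, 4}, {0, 3, 4}, {1, 2, 3}, {1, 2, 4}, {1, 3, 4}, {2, 3, 4},
   {0, 1, 2, 3}, {0, 1, 2, 4}, {0, 1, 3, 4}, {0, 2, 3, 4}, {1, 2, 3, 4},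
   {0, 1, 2, 3, 4}]

/-- The coefficient vector whose entries in the order of `subsets` are listed in `q`. -/
def ofList (q : List ℤ) : EntropyIneq 5 := fun I => q.getD (subsets.idxOf I) 0

/-- The coefficients of the genuinely five-partite inequalities, in the order of `subsets`. -/
def genuineCoeffs : List (List ℤ) :=
  [[0, -1, 0, -1, 0, 1, -1, 1, 0, 1, 1, 0, 0, 0, 0, 0, -1, 0, 0, 1, 0, 0, -1, 0, 1, 0, 0, 0, -1, 0, 0],
   [0, -1, 0, 0, -1, 1, -1, 0, 0, 0, 0, 1, 0, 1, 0, 0, 0, 0, 1, 0, 1, 1, 0, -1, 0, -1, 0, 0, -1, 0, 0],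
   [0, -1, 0, 0, 0, 1, -1, 0, 0, 1, 0, 0, 0, 0, -1, 0, 0, 0, 1, 0, 1, -1, 0, 1, 1, 0, 0, -1, -1, 0, 0],
   [-2, -2, 0, 0, 0, 2, 1, 1, 1, 1, 1, 1, 0, 0, 0, -1, -1, -1, 0, 0, 0, 0, 0, 0, -1, 0, 0, 0, 0, 0, 0],
   [-1, -2, 0, 0, 0, 2, -1, 1, 1, 1, 1, 1, 0, 0, -1, 0, -1, -1, 0, 0, 0, 0, 0, 0, 1, 0, 0, 0, 0, -1, 0],
   [-1, 0, -1, -1, 0, 1, 1, 1, 1, 1, 0, -1, 1, 0, 1, -1, 0, 0, -1, 0, -1, 0, 0, 0, 0, 0, 0, 0, 0, 0, 0],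
   [0, -1, -1, -1, 0, 1, 1, 1, -1, 1, 1, 0, 0, 1, 1, -1, -1, 0, 0, 0, 0, 0, 0, 0, -1, 0, 0, 0, 0, 0, 0],
   [0, 0, 0, -1, 0, 0, 0, 1, 0, -1, 0, -1, 0, 0, 0, 1, -1, 1, 0, -1, 0, 1, 2, 1, 1, 0, -1, 0, 0, -2, 0],
   [0, 0, 0, 0, 0, 0, 0, -1, 0, -1, 0, 0, 0, -1, 0, 1, 1, 0, 0, 1, 1, 1, 1, -1, 1, -1, -1, 0, -1, 0, 0],
   [0, 0, 0, 0, 0, 0, 0, 0, -1, -1, -1, 0, -1, 0, 0, 1, 1, 0, 1, 0, 0, 2, 1, 1, 1, -2, 0, 0, 0, -2, 0],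
   [0, 0, 0, 0, 0, 0, 0, 0, 0, -1, -1, 0, 0, 0, -1, 1, 1, 0, 0, -1, 1, 1, 1, 1, 1, -1, 0, -1, 0, -1, 0],
   [-2, 0, 0, 0, -2, 2, 1, 1, 1, -1, -1, 2, 0, 1, 1, 0, 0, -2, -1, 0, 0, 1, 0, 0, 0, 0, 0, 0, 0, -1, 0],
   [-1, -2, 0, 0, 0, 2, 1, 1, -1, 1, 1, 1, -1, 0, 0, -1, -1, 0, 0, 0, 1, 0, 0, -1, 1, 0, 0, 0, -1, 0, 0],
   [-1, 0, -1, 0, 0, 1, 1, 1, 0, 0, -1, 0, 1, 0, -1, 0, 0, 0, -1, -1, 1, 0, 1, 1, 1, 0, 0, -1, 0, -1, 0],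
   [-1, 0, 0, -2, -1, 1, 1, 2, -1, -1, 1, 1, 1, 1, 2, 0, -1, 0, -1, 0, 0, 0, 0, -1, -1, 0, 0, 0, 0, 0, 0],
   [0, -1, 0, -1, 0, 1, -1, 1, 0, 1, 0, 0, 1, -1, 0, 0, 0, 0, 0, 1, -1, -1, 1, 1, 1, 0, -1, 0, 0, -1, 0],
   [0, 0, -1, 0, 0, 0, 0, 0, -1, 0, -2, 0, 0, 1, 0, 1, 1, 1, 1, 0, 1, 2, -1, 2, -1, -2, 0, -2, 0, 0, 0],
   [0, 0, 0, -1, -1, 0, -1, 1, 1, 0, 0, -1, 0, 1, 1, 1, -1, 1, 0, 0, -1, 1, 0, 1, 0, 0, -1, 0, 0, -1, 0],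
   [0, 0, 0, 0, -1, 0, 0, -1, 1, -1, 0, 0, -1, 0, 1, 1, 1, 0, 1, -1, 0, 2, 1, -1, 1, -2, 0, 0, 0, -1, 0],
   [0, 0, 0, 0, 0, 0, -1, 0, -1, -1, 0, -1, 0, 0, 0, 2, -1, 2, 1, 1, 1, 1, 1, 1, -1, -1, -2, -1, 0, 0, 0],
   [-3, 0, -1, 0, 0, 2, 2, 1, 2, 1, 0, -2, -1, 1, 0, -1, -1, 0, 0, -1, -1, 1, 0, 2, 1, 0, 0, 0, 0, -2, 0],
   [-2, 0, -1, 0, 0, 1, 1, 2, 1, 0, -1, 0, 1, 0, -1, 0, 0, -1, -2, 0, 0, 1, 1, 1, 1, 0, 0, 0, 0, -2, 0],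
   [-2, 0, 0, 0, 0, 1, 0, 1, 2, -1, 0, -1, -1, 0, -1, 1, -1, 0, 1, -2, 0, 2, 2, 1, 2, -1, 0, 0, 0, -3, 0],
   [-2, 0, 0, 0, 0, 1, 1, 1, 1, 0, -1, 0, 0, -2, 0, 0, 0, 0, -1, 1, -1, 1, 1, 1, 2, 0, -1, 0, 0, -2, 0]]

/-- The genuinely five-partite inequalities. -/
def genuine (i : Fin 24) : EntropyIneq 5 := ofList (genuineCoeffs.getD i [])

/-- The representatives of the five-party quantum linear rank inequalities. -/
def qlr : Fin 7 ⊕ Fin 24 → EntropyIneq 5 := Sum.elim uplifted genuine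

/-- All the uplifted inequalities, and the numbers 1, 2, 3, 6, 7, 9, 11 (counted from 1) of the
genuinely five-partite ones. -/
def proven : Finset (Fin 7 ⊕ Fin 24) :=
  Finset.univ.disjSum {0, 1, 2, 5, 6, 8, 10}

end EntropyIneq

/-! ### Cuts seen hyperedge by hyperedge -/

namespace ColoredHypergraph

variable {n : ℕ} {V : Type u}

/-! Validity is proof by contraction. Cuts for the left-hand terms give each vertex a bit string,
and each bit of its image under `f` defines a cut for a right-hand term. The occurrence condition
makes these cuts admissible. A hyperedge with `k` vertices yields `k` bit strings, so contraction of
rank `k` says that it costs the new cuts no more than the old ones; summing over hyperedges proves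
the inequality (`holdsOn_of_isContractionMap`).

All ranks are handled by one finite check. If `k` bit strings disagree in `d` positions, they lie in
a common subcube of dimension `d`, and a component of `f` that separates them is not constant there.
In the fourteen cases all coefficients are `±1`, so it suffices that on each of the `3 ^ L` subcubes
at most as many components of `f` are non-constant as the dimension
(`TruthTable.countP_le_of_contracts`). Here `L ≤ 7`, and explicit truth tables are checked by
evaluation.

Inequivalence follows from `pairInvariant`, which separates the 31 vectors; the positive factor is
`1` because each vector has an entry `±1`. -/

theorem cutWeight_eq_tsum_indicator (H : ColoredHypergraph n V) (W : Set V) :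
    H.cutWeight W = ∑' e : H.edges, (H.cutEdges W).indicator (fun e => (H.weight e : ℝ≥0∞)) e :=
  tsum_subtype (H.cutEdges W) fun e => (H.weight e : ℝ≥0∞)

theorem finite_of_weight_ne_zero {H : ColoredHypergraph n V} (hH : H.FiniteRank) {e : H.edges}
    (he : H.weight e ≠ 0) : (e : Set V).Finite :=
  Set.encard_ne_top_iff.1 <| ne_top_of_le_ne_top hH <|
    le_iSup₂_of_le (f := fun (e : H.edges) (_ : H.weight e ≠ 0) => (e : Set V).encard) e he le_rfl

/-- A hyperedge is cut by `W` unless membership in `W` is constant on it. -/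
theorem mem_cutEdges_iff (H : ColoredHypergraph n V) (W : Set V) (e : H.edges) :
    e ∈ H.cutEdges W ↔ ¬ ∀ u ∈ (e : Set V), ∀ v ∈ (e : Set V), u ∈ W ↔ v ∈ W := by
  constructor
  · rintro ⟨⟨u, hu, huW⟩, ⟨v, hv, hvW⟩⟩ h
    exact hvW ((h u hu v hv).1 huW)
  · intro h
    push Not at h
    obtain ⟨u, hu, v, hv, ⟨h1, h2⟩ | ⟨h1, h2⟩⟩ := h
    · exact ⟨⟨u, hu, h1⟩, ⟨v, hv, h2⟩⟩
    · exact ⟨⟨v, hv, h2⟩, ⟨u, hu, h1⟩⟩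

theorem isCut_iff (H : ColoredHypergraph n V) (I : Finset (Fin n)) (W : Set V) :
    H.IsCut I W ↔
      ∀ v : H.boundary, (v : V) ∈ W ↔ EntropyIneq.occurrence (H.color v) I = true := by
  have hocc : ∀ v : H.boundary, EntropyIneq.occurrence (H.color v) I = true ↔
      ∃ i ∈ I, H.color v = i.castSucc := by
    intro v
    simp [EntropyIneq.occurrence, eq_comm]
  simp only [hocc, IsCut, Set.ext_iff]
  constructor
  · intro h v
    have := h v
    simpa using this
  · intro h v
    by_cases hv : v ∈ H.boundary
    · have := h ⟨v, hv⟩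
      simpa [hv] using this
    · simp [hv]

end ColoredHypergraph

/-! ### Proof by contraction -/

namespace EntropyIneq

variable {n : ℕ} {V : Type u}

/-- The set of vertices that the contraction map `f` assigns to the term `r` of the right-hand
side, given cuts for the terms of the left-hand side. -/
def contractedCut {Q : EntropyIneq n} (f : (Q.LHS → Bool) → (Q.RHS → Bool))
    (W : Q.LHS → Set V) (r : Q.RHS) : Set V :=
  open scoped Classical in {v | f (fun l => decide (v ∈ W l)) r = true}

/-- The bit string of a boundary vertex of colour `c` is the occurrence vector of `c`, whose image
under `f` is prescribed. -/
theorem isCut_contractedCut {Q : EntropyIneq n} {k : ℕ} {f : (Q.LHS → Bool) → (Q.RHS → Bool)}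
    (hf : Q.IsContractionMap k f) (H : ColoredHypergraph n V) {W : Q.LHS → Set V}
    (hW : ∀ l, H.IsCut l.1 (W l)) (r : Q.RHS) : H.IsCut r.1 (contractedCut f W r) := by
  classical
  rw [ColoredHypergraph.isCut_iff]
  intro v
  have : (fun l : Q.LHS => decide ((v : V) ∈ W l)) = fun l => occurrence (H.color v) l.1 := by
    funext l
    have := (H.isCut_iff l.1 (W l)).1 (hW l) v
    by_cases h : (v : V) ∈ W l <;> simp_all
  simp only [contractedCut, Set.mem_ofPred_eq]
  convert Iff.rfl
  exact (congrFun (hf.occurrence_eq (H.color v)) r).symm.trans (by rw [← this])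

/-- Hyperedge by hyperedge, the contracted cuts weigh at most as much as the given ones. -/
theorem sum_indicator_contractedCut_le {Q : EntropyIneq n}
    {f : (Q.LHS → Bool) → (Q.RHS → Bool)} (hf : ∀ k, 2 ≤ k → Q.IsContractionMap k f)
    (H : ColoredHypergraph n V) (W : Q.LHS → Set V) (e : H.edges) (he : (e : Set V).Finite) :
    ∑ r, (H.cutEdges (contractedCut f W r)).indicator (fun e => (H.weight e : ℝ≥0∞)) e ≤
      ∑ l : Q.LHS, ((Q l.1).toNat : ℝ≥0∞) *
        (H.cutEdges (W l)).indicator (fun e => (H.weight e : ℝ≥0∞)) e := by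
  classical
  have : Finite (e : Set V) := he
  obtain ⟨k, ⟨φ⟩⟩ := Finite.exists_equiv_fin (e : Set V)
  have hk : 2 ≤ k := by
    have h2 := H.two_le_encard e e.2
    rw [← Set.Finite.cast_ncard_eq he, ← Nat.card_coe_set_eq, Nat.card_congr φ, Nat.card_fin] at h2
    exact_mod_cast h2
  -- The bit strings are the membership patterns of the `k` vertices of `e`; they disagree at `l`
  -- exactly when `W l` cuts `e`.
  have key := (hf k hk).contracts fun i l => decide ((φ.symm i : V) ∈ W l)
  rw [weightedIndicator, weightedIndicator] at key
  have hcut : ∀ U : Set V, e ∈ H.cutEdges U ↔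
      ¬ ∀ i j, ((φ.symm i : V) ∈ U ↔ (φ.symm j : V) ∈ U) := by
    intro U
    rw [ColoredHypergraph.mem_cutEdges_iff, not_iff_not]
    constructor
    · intro h i j
      exact h _ (φ.symm i).2 _ (φ.symm j).2
    · intro h u hu v hv
      simpa using h (φ ⟨u, hu⟩) (φ ⟨v, hv⟩)
  have hind : ∀ U : Set V, (H.cutEdges U).indicator (fun e => (H.weight e : ℝ≥0∞)) e =
      ((if ∀ i j, ((φ.symm i : V) ∈ U ↔ (φ.symm j : V) ∈ U) then 0 else 1 : ℕ) : ℝ≥0∞) *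
        H.weight e := by
    intro U
    rw [Set.indicator_apply, hcut]
    split_ifs <;> simp_all
  simp only [hind, ← mul_assoc, ← Finset.sum_mul]
  gcongr
  have hL : (∑ r, (if ∀ i j, ((φ.symm i : V) ∈ contractedCut f W r ↔
        (φ.symm j : V) ∈ contractedCut f W r) then 0 else 1 : ℕ)) ≤
      ∑ l : Q.LHS, (Q l.1).toNat *
        (if ∀ i j, ((φ.symm i : V) ∈ W l ↔ (φ.symm j : V) ∈ W l) then 0 else 1 : ℕ) := by
    convert key using 3 with r _ l _
    · simp only [contractedCut, Set.mem_ofPred_eq, one_mul, ← Bool.eq_iff_iff]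
    · simp only [decide_eq_decide]
  exact_mod_cast hL

/-- Proof by contraction: a map that is a contraction map of every rank shows the inequality on
all hypergraphs of finite rank. -/
theorem holdsOn_of_isContractionMap {Q : EntropyIneq n} {f : (Q.LHS → Bool) → (Q.RHS → Bool)}
    (hf : ∀ k, 2 ≤ k → Q.IsContractionMap k f) (H : ColoredHypergraph n V) (hH : H.FiniteRank) :
    Q.HoldsOn H := by
  have hR : ∑ I, ((-Q I).toNat : ℝ≥0∞) * H.entropy I = ∑ r : Q.RHS, H.entropy r.1 := by
    rw [Fintype.sum_sigma]
    simp
  have hLsum : ∀ g : Finset (Fin n) → ℝ≥0∞,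
      ∑ I, ((Q I).toNat : ℝ≥0∞) * g I = ∑ l : Q.LHS, ((Q l.1).toNat : ℝ≥0∞) * g l.1 := by
    intro g
    rw [← Finset.sum_subtype {I | 0 < Q I} (p := fun I => 0 < Q I) (by simp)
      fun I => ((Q I).toNat : ℝ≥0∞) * g I, Finset.sum_filter]
    refine Finset.sum_congr rfl fun I _ => ?_
    split_ifs with h
    · rfl
    · simp [Int.toNat_of_nonpos (not_lt.1 h)]
  have hcuts : ∀ W : Q.LHS → Set V, (∀ l, H.IsCut l.1 (W l)) →
      ∑ r : Q.RHS, H.entropy r.1 ≤ ∑ l : Q.LHS, ((Q l.1).toNat : ℝ≥0∞) * H.cutWeight (W l) := by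
    intro W hW
    calc ∑ r : Q.RHS, H.entropy r.1
        ≤ ∑ r : Q.RHS, H.cutWeight (contractedCut f W r) :=
          Finset.sum_le_sum fun r _ => iInf₂_le _ (isCut_contractedCut (hf 2 le_rfl) H hW r)
      _ ≤ ∑ l : Q.LHS, ((Q l.1).toNat : ℝ≥0∞) * H.cutWeight (W l) := by
          simp only [ColoredHypergraph.cutWeight_eq_tsum_indicator, ← ENNReal.tsum_mul_left]
          rw [← Summable.tsum_finsetSum fun _ _ => ENNReal.summable,
            ← Summable.tsum_finsetSum fun _ _ => ENNReal.summable]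
          refine ENNReal.tsum_le_tsum fun e => ?_
          -- Finite rank says nothing about hyperedges of weight zero, which may be infinite but
          -- contribute nothing.
          by_cases he : H.weight e = 0
          · classical simp [Set.indicator_apply, he]
          · exact sum_indicator_contractedCut_le hf H W e
              (ColoredHypergraph.finite_of_weight_ne_zero hH he)
  rw [HoldsOn, hR, hLsum]
  by_cases htop : ∃ l : Q.LHS, H.entropy l.1 = ⊤
  · obtain ⟨l, hl⟩ := htop
    refine le_top.trans_eq (Eq.symm ?_)
    refine ENNReal.sum_eq_top.2 ⟨l, Finset.mem_univ _, ?_⟩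
    rw [hl, ENNReal.mul_top]
    have := l.2
    simp only [ne_eq, Nat.cast_eq_zero]
    omega
  push Not at htop
  -- The infima need not be attained, so near-optimal cuts are used. The extra `1` in `N` keeps it
  -- positive, and the total error is at most `ε`.
  refine ENNReal.le_of_forall_pos_le_add fun ε hε _ => ?_
  set N : ℝ≥0 := ∑ l : Q.LHS, ((Q l.1).toNat : ℝ≥0) + 1 with hN
  have hNpos : 0 < N := by positivity
  have hW : ∀ l : Q.LHS, ∃ W, H.IsCut l.1 W ∧ H.cutWeight W ≤ H.entropy l.1 + (ε / N : ℝ≥0) := by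
    intro l
    have hlt : H.entropy l.1 < H.entropy l.1 + (ε / N : ℝ≥0) :=
      ENNReal.lt_add_right (htop l) (by
        rw [ENNReal.coe_ne_zero]
        positivity)
    conv_lhs at hlt => rw [ColoredHypergraph.entropy]
    simp only [iInf_lt_iff] at hlt
    obtain ⟨W, hW, h⟩ := hlt
    exact ⟨W, hW, h.le⟩
  choose W hW hWle using hW
  calc ∑ r : Q.RHS, H.entropy r.1
      ≤ ∑ l : Q.LHS, ((Q l.1).toNat : ℝ≥0∞) * H.cutWeight (W l) := hcuts W hW
    _ ≤ ∑ l : Q.LHS, ((Q l.1).toNat : ℝ≥0∞) * (H.entropy l.1 + (ε / N : ℝ≥0)) := by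
        gcongr with l
        exact hWle l
    _ = ∑ l : Q.LHS, ((Q l.1).toNat : ℝ≥0∞) * H.entropy l.1 +
          (((∑ l : Q.LHS, ((Q l.1).toNat : ℝ≥0)) * (ε / N) : ℝ≥0) : ℝ≥0∞) := by
        simp only [mul_add, Finset.sum_add_distrib, ← Finset.sum_mul]
        push_cast
        rfl
    _ ≤ ∑ l : Q.LHS, ((Q l.1).toNat : ℝ≥0∞) * H.entropy l.1 + ε := by
        gcongr
        rw [mul_div_left_comm]
        refine mul_le_of_le_one_right zero_le ?_
        rw [div_le_one hNpos, hN]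
        exact le_self_add

end EntropyIneq

/-! ### Truth tables -/

namespace TruthTable

variable {ι ρ : Type*}

/-- The Boolean function of the variables `ls` whose truth table is `t`: the value at `x` is the
bit of `t` at the position with binary digits `x l`, the head of `ls` being the leading one. -/
def eval : List ι → ℕ → (ι → Bool) → Bool
  | [], t, _ => t.testBit 0
  | l :: ls, t, x => eval ls (if x l then t >>> 2 ^ ls.length else t) x

theorem eval_and (ls : List ι) (s t : ℕ) (x : ι → Bool) :
    eval ls (s &&& t) x = (eval ls s x && eval ls t x) := by
  induction ls generalizing s t with
  | nil => simp [eval]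
  | cons l ls ih =>
    simp only [eval]
    split_ifs
    · rw [Nat.shiftRight_and_distrib, ih]
    · rw [ih]

theorem eval_or (ls : List ι) (s t : ℕ) (x : ι → Bool) :
    eval ls (s ||| t) x = (eval ls s x || eval ls t x) := by
  induction ls generalizing s t with
  | nil => simp [eval]
  | cons l ls ih =>
    simp only [eval]
    split_ifs
    · rw [Nat.shiftRight_or_distrib, ih]
    · rw [ih]

/-- Given lower and upper bounds for a list of Boolean functions of `m` variables, checks on every
subcube that at most `b` more of the functions than the dimension of the subcube have lower and
upper bounds that differ for the subcube. -/
def contracts : ℕ → ℕ → List (ρ × ℕ × ℕ) → Bool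
  | 0, b, ts => ts.countP (fun p => p.2.1.testBit 0 != p.2.2.testBit 0) ≤ b
  | m + 1, b, ts =>
    contracts m b ts &&
    contracts m b (ts.map fun p => (p.1, p.2.1 >>> 2 ^ m, p.2.2 >>> 2 ^ m)) &&
    contracts m (b + 1)
      (ts.map fun p => (p.1, p.2.1 &&& p.2.1 >>> 2 ^ m, p.2.2 ||| p.2.2 >>> 2 ^ m))

/-- Induction on the variables. One that is constant along the points restricts the bounds to a
face; one that varies is freed: the bounds become the conjunction and disjunction over both faces,
and the budget grows by the one position that disagrees. -/
theorem countP_le_of_contracts {k : ℕ} {ls : List ι} {b : ℕ} {ts : List (ρ × ℕ × ℕ)}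
    (h : contracts ls.length b ts) (x : Fin k → ι → Bool) (F : ρ → Fin k → Bool)
    (hF : ∀ p ∈ ts, ∀ i, (eval ls p.2.1 (x i) → F p.1 i) ∧ (F p.1 i → eval ls p.2.2 (x i))) :
    ts.countP (fun p => ¬ ∀ i j, F p.1 i = F p.1 j) ≤
      b + ls.countP (fun l => ¬ ∀ i j, x i l = x j l) := by
  induction ls generalizing b ts with
  | nil =>
    simp only [List.length_nil, contracts, decide_eq_true_eq] at h
    -- Equal bounds force `F p.1` to be constant, so only functions whose bounds differ are counted.
    refine le_trans (List.countP_mono_left fun p hp hne => ?_) (h.trans (Nat.le_add_right _ _))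
    simp only [eval] at hF
    by_contra hcon
    simp only [bne_iff_ne, ne_eq, not_not] at hcon
    refine of_decide_eq_true hne fun i j => ?_
    have hi := hF p hp i
    have hj := hF p hp j
    rw [hcon] at hi hj
    rw [Bool.eq_iff_iff]
    tauto
  | cons l ls ih =>
    simp only [List.length_cons, contracts, Bool.and_eq_true] at h
    obtain ⟨⟨h0, h1⟩, h2⟩ := h
    simp only [eval] at hF
    rw [List.countP_cons]
    by_cases hx : ∀ i j, x i l = x j l
    · have hconst : (∀ i, x i l = false) ∨ ∀ i, x i l = true := by
        by_contra! hcon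
        obtain ⟨⟨i, hi⟩, ⟨j, hj⟩⟩ := hcon
        have := hx i j
        simp_all
      rw [if_neg (by simpa using hx), add_zero]
      rcases hconst with hc | hc
      · exact ih h0 fun p hp i => by simpa [hc i] using hF p hp i
      · refine le_trans (le_of_eq ?_) (ih h1 ?_)
        · rw [List.countP_map]
          rfl
        · intro q hq i
          obtain ⟨p, hp, rfl⟩ := List.mem_map.1 hq
          simpa [hc i] using hF p hp i
    · rw [if_pos (by simpa using hx), ← add_assoc, add_right_comm]
      refine le_trans (le_of_eq ?_) (ih h2 ?_)
      · rw [List.countP_map]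
        rfl
      · intro q hq i
        obtain ⟨p, hp, rfl⟩ := List.mem_map.1 hq
        have := hF p hp i
        simp only [eval_and, eval_or]
        cases hxi : x i l <;> simp_all

end TruthTable

/-! ### Certificates for coefficients `±1` -/

namespace EntropyIneq

variable {n : ℕ}

/-- `ls` lists the terms of the left-hand side and `ts` those of the right-hand side with the truth
tables of a contraction map; all coefficients are `±1`. -/
structure IsCertificate (Q : EntropyIneq n) (ls : List (Finset (Fin n)))
    (ts : List (Finset (Fin n) × ℕ)) : Prop where
  nodup : ls.Nodup
  coeff : ∀ I, Q I = if I ∈ ls then 1 else if I ∈ ts.map Prod.fst then -1 else 0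
  occurrence_eq : ∀ c, ∀ t ∈ ts, TruthTable.eval ls t.2 (occurrence c) = occurrence c t.1
  contracts : TruthTable.contracts ls.length 0 (ts.map fun t => (t, t.2, t.2))

instance (Q : EntropyIneq n) (ls : List (Finset (Fin n))) (ts : List (Finset (Fin n) × ℕ)) :
    Decidable (Q.IsCertificate ls ts) :=
  decidable_of_iff (ls.Nodup ∧
    (∀ I, Q I = if I ∈ ls then 1 else if I ∈ ts.map Prod.fst then -1 else 0) ∧
    (∀ c, ∀ t ∈ ts, TruthTable.eval ls t.2 (occurrence c) = occurrence c t.1) ∧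
    TruthTable.contracts ls.length 0 (ts.map fun t => (t, t.2, t.2)))
    ⟨fun ⟨h1, h2, h3, h4⟩ => ⟨h1, h2, h3, h4⟩, fun ⟨h1, h2, h3, h4⟩ => ⟨h1, h2, h3, h4⟩⟩

theorem IsCertificate.exists_isContractionMap {Q : EntropyIneq n} {ls : List (Finset (Fin n))}
    {ts : List (Finset (Fin n) × ℕ)} (h : Q.IsCertificate ls ts) :
    ∃ f, ∀ k, Q.IsContractionMap k f := by
  classical
  have hls : ∀ I ∈ ls, 0 < Q I := fun I hI => by simp [h.coeff, hI]
  have hts : ∀ r : Q.RHS, ∃ t ∈ ts, t.1 = r.1 := by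
    rintro ⟨I, j⟩
    have := j.pos
    have hc := h.coeff I
    split_ifs at hc with h1 h2
    · omega
    · simpa using h2
    · omega
  have hRHS : ∀ r : Q.RHS, (-Q r.1).toNat = 1 := by
    rintro ⟨I, j⟩
    have := j.pos
    have hc := h.coeff I
    dsimp only
    split_ifs at hc <;> omega
  choose τ hτ hτ' using hts
  -- Each right-hand term occurs once, so its set determines it.
  have hinj : Function.Injective τ := by
    rintro ⟨I, j⟩ ⟨I', j'⟩ hr
    obtain rfl : I = I' := by simpa [hτ'] using congrArg Prod.fst hr
    have hI : (-Q I).toNat = 1 := hRHS ⟨I, j⟩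
    congr 1
    ext
    omega
  -- The default `false` is never read: `eval` only consults `ls`, whose members all have positive
  -- coefficient.
  let ext : (Q.LHS → Bool) → Finset (Fin n) → Bool :=
    fun x I => if hI : 0 < Q I then x ⟨I, hI⟩ else false
  have hext : ∀ (ls' : List (Finset (Fin n))) (t : ℕ) (x y : Finset (Fin n) → Bool),
      (∀ I ∈ ls', x I = y I) → TruthTable.eval ls' t x = TruthTable.eval ls' t y := by
    intro ls' t x y hxy
    induction ls' generalizing t with
    | nil => rfl
    | cons I ls' ih =>
      simp only [TruthTable.eval]
      rw [hxy I (by simp), ih _ fun J hJ => hxy J (by simp [hJ])]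
  refine ⟨fun x r => TruthTable.eval ls (τ r).2 (ext x), fun k => ⟨fun c => ?_, fun x => ?_⟩⟩
  · funext r
    rw [← hτ' r, ← h.occurrence_eq c _ (hτ r)]
    exact hext _ _ _ _ fun I hI => by simp [ext, hls I hI]
  · have key := TruthTable.countP_le_of_contracts h.contracts (fun i => ext (x i))
      (fun t i => TruthTable.eval ls t.2 (ext (x i))) (by
        intro p hp i
        obtain ⟨t, -, rfl⟩ := List.mem_map.1 hp
        -- Before any variable is freed, both bounds are the function itself.
        exact ⟨id, id⟩)
    rw [List.countP_map, zero_add] at key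
    have hR : weightedIndicator (fun _ : Q.RHS => 1)
        (fun i r => TruthTable.eval ls (τ r).2 (ext (x i))) ≤
        ts.countP (fun t => ¬ ∀ i j, TruthTable.eval ls t.2 (ext (x i)) =
          TruthTable.eval ls t.2 (ext (x j))) := by
      rw [List.countP_eq_length_filter]
      refine le_trans ?_ (List.toFinset_card_le _)
      have hcard : ∀ (p : Q.RHS → Prop) [DecidablePred p], ∑ r, (1 * if p r then 0 else 1) =
          (Finset.univ.filter fun r => ¬ p r).card := fun p _ => by
        simp only [Finset.card_filter, one_mul, ite_not]
      rw [weightedIndicator, hcard]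
      refine Finset.card_le_card_of_injOn τ (fun r hr => ?_) hinj.injOn
      simpa [hτ] using hr
    have hL : ls.countP (fun I => ¬ ∀ i j, ext (x i) I = ext (x j) I) ≤
        weightedIndicator (fun l : Q.LHS => (Q l.1).toNat) x := by
      rw [List.countP_eq_length_filter, ← List.toFinset_card_of_nodup (h.nodup.filter _)]
      calc _ ≤ (Finset.univ.filter fun l : Q.LHS => ¬ ∀ i j, x i l = x j l).card := by
            rw [← Finset.card_map (Function.Embedding.subtype _)]
            refine Finset.card_le_card fun I hI => ?_
            simp only [List.mem_toFinset, List.mem_filter, decide_eq_true_eq] at hI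
            have hQ := hls I hI.1
            refine Finset.mem_map.2 ⟨⟨I, hQ⟩, ?_, rfl⟩
            simpa [ext, hQ] using hI.2
        _ ≤ _ := by
            rw [Finset.card_filter, weightedIndicator]
            refine Finset.sum_le_sum fun l _ => ?_
            have : 1 ≤ (Q l.1).toNat := by
              have := l.2
              omega
            split_ifs <;> simp_all
    exact hR.trans (key.trans hL)

/-! ### The fourteen contraction maps -/

/-- The truth tables of contraction maps for the inequalities in `proven`, one for each term of the
right-hand side, in the order of `subsets`. -/
def truthTables : Fin 7 ⊕ Fin 24 → List ℕ
  | .inl 0 => [0xe]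
  -- Conjunction and disjunction: the intersection and union of cuts, as in submodularity.
  | .inl 1 => [8, 0xe]
  | .inl 2 => [8, 0xe]
  | .inl 3 => [0xf0008000, 0x88880000, 0xeee0eca0, 0xffffffcc, 0xfffefafa]
  | .inl 4 => [0xf8000000, 0x80808080, 0xeeecea00, 0xfffffcfc, 0xfffaffea]
  | .inl 5 => [0xcc008000, 0xa0a00000, 0xfffffff0, 0xfac8f888, 0xfffeeeee]
  | .inl 6 => [0xf0008000, 0x88880000, 0xeee0eca0, 0xffffffcc, 0xfffefafa]
  | .inr 0 =>
    [0xfa00f00000000000, 0xa0a00000a0a00000, 0xcccc8880c8008800, 0xfffffffffffff0f0,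
     0xfffafff8ffc8ff88, 0xffffeeeefefeeeee]
  | .inr 1 =>
    [0xaaaa880000000000, 0xcc000000cc000000, 0xf0c0f0c0a080a000, 0xffffeeaaffffcc80,
     0xfffffffffafafafa, 0xfffcfffcffecffec]
  | .inr 2 =>
    [0xecec000000000000, 0xfa00f800ea000000, 0x8080808080808080, 0xffffeeecffffea00,
     0xfffffffffcfcfcfc, 0xfffafffaffeaffea]
  | .inr 5 =>
    [0xff00a800e000a0000000000000000000, 0xe0e0c0c000000000e0e0c0c000000000,
     0x88880000888800008888000088880000, 0xfefefefcfef0faf0fe00aa00ee00aa00,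
     0xfffffffffffffffffffffffff0f0f0f0, 0xffffffffffffccccfffffcfcffffcccc,
     0xffffffaaffeeffaafffeffaaffeeffaa]
  | .inr 6 =>
    [0xfac8f0c0fa00f0000000000000000000, 0xcc00cc0000000000cc00cc0000000000,
     0xa0a00000a0a00000a0a00000a0a00000, 0xffffaaa8ccc88888fac8aa88c8c88888,
     0xffffffffffffffffffffffffff00ff00, 0xfffffffffffffff0fffff0f0fffff0f0,
     0xfffefffefffeeeeefffeffeefefeeeee]
  | .inr 8 =>
    [0xff00a80000000000e000a00000000000, 0xe0e0c0c0e0e0c0c00000000000000000,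
     0x88880000888800008888000088880000, 0xfefefefcfe00aa00fef0faf0ee00aa00,
     0xfffffffffffffffffffffffff0f0f0f0, 0xfffffffffffffcfcffffccccffffcccc,
     0xffffffaafffeffaaffeeffaaffeeffaa]
  | .inr 10 =>
    [0xf0e0f0c0f000f0000000000000000000, 0xee00cc0000000000ee00cc0000000000,
     0x88880000888800008888000088880000, 0xffffaaa8eee0aaa0f0e0a0a0e0e0a0a0,
     0xffffffffffffffffffffffffff00ff00, 0xffffffffffffccccffffffccffffcccc,
     0xfffefffefffefffafffefafafefefafa]
  | _ => []

/-- The terms of the left-hand side. -/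
def leftTerms (Q : EntropyIneq 5) : List (Finset (Fin 5)) := subsets.filter fun I => 0 < Q I

/-- The terms of the right-hand side. -/
def rightTerms (Q : EntropyIneq 5) : List (Finset (Fin 5)) := subsets.filter fun I => Q I < 0

theorem isCertificate_truthTables : ∀ i ∈ proven, (qlr i).IsCertificate (leftTerms (qlr i))
    ((rightTerms (qlr i)).zip (truthTables i)) := by
  -- A list of tables that is too short for `zip` would violate `coeff`.
  decide +kernel

/-! ### Pairwise inequivalence -/

/-- The coefficients of the sets that contain two given colours, weighted with the sizes of the
sets; a quantity that is invariant under permutations of the colours. -/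
def pairInvariant (Q : EntropyIneq n) : ℤ :=
  ∑ i, ∑ j, (∑ J, if i ∈ J ∧ j ∈ J then (J.card : ℤ) * Q (unpurify J) ^ 2 else 0) ^ 2

theorem pairInvariant_eq_of_perm {Q Q' : EntropyIneq n} (σ : Equiv.Perm (Fin (n + 1)))
    (h : ∀ J, Q' (unpurify J) = Q (unpurify (J.map σ.toEmbedding))) :
    Q'.pairInvariant = Q.pairInvariant := by
  refine Fintype.sum_equiv σ _ _ fun i => Fintype.sum_equiv σ _ _ fun j =>
    congrArg (· ^ 2) (Fintype.sum_equiv σ.finsetCongr _ _ fun J => ?_)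
  simp [h, Equiv.finsetCongr_apply]

/-- Equivalent inequalities with a coefficient `±1` each differ by a permutation only. -/
theorem Equivalent.pairInvariant_eq {Q Q' : EntropyIneq n} (h : Q.Equivalent Q')
    (hQ : ∃ J : Finset (Fin (n + 1)), (Q (unpurify J)).natAbs = 1)
    (hQ' : ∃ J : Finset (Fin (n + 1)), (Q' (unpurify J)).natAbs = 1) :
    Q'.pairInvariant = Q.pairInvariant := by
  obtain ⟨σ, c, hc, h⟩ := h
  refine pairInvariant_eq_of_perm σ ?_
  have habs : ∀ z : ℤ, z.natAbs = 1 → |(z : ℚ)| = 1 := by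
    intro z hz
    rcases Int.natAbs_eq_iff.1 hz with rfl | rfl <;> simp
  -- An entry `±1` of `Q` becomes an entry `±c` of the integer vector `Q'`, so `c` is a positive
  -- integer.
  have hge : 1 ≤ c := by
    obtain ⟨J, hJ⟩ := hQ
    have h1 := h (J.map σ.symm.toEmbedding)
    have h2 : (J.map σ.symm.toEmbedding).map σ.toEmbedding = J := by
      simp [Finset.map_map]
    rw [h2] at h1
    have h3 := congrArg abs h1
    rw [abs_mul, habs _ hJ, mul_one, abs_of_pos hc, ← Int.cast_abs] at h3
    rw [← h3] at hc ⊢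
    exact_mod_cast hc
  -- An entry `±1` of `Q'` is `c` times a non-zero integer.
  have hle : c ≤ 1 := by
    obtain ⟨J, hJ⟩ := hQ'
    have h1 := congrArg abs (h J)
    rw [abs_mul, habs _ hJ, abs_of_pos hc, ← Int.cast_abs] at h1
    set m := |Q (unpurify (J.map σ.toEmbedding))|
    have hm : 0 < (m : ℚ) := by
      by_contra! hm
      nlinarith
    have hm1 : (1 : ℚ) ≤ m := by exact_mod_cast hm
    nlinarith
  intro J
  have := h J
  rw [le_antisymm hle hge, one_mul] at this
  exact_mod_cast this

theorem exists_natAbs_qlr_eq_one :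
    ∀ i, ∃ J : Finset (Fin 6), (qlr i (unpurify J)).natAbs = 1 := by
  decide +kernel

theorem pairInvariant_qlr : ∀ i, (qlr i).pairInvariant = Sum.elim
    ![3672, 3960, 2456, 20192, 16616, 18432, 12488]
    ![25808, 25520, 22016, 124056, 89672, 38528, 38240, 56088, 24120, 67680, 24264, 195048,
      101552, 41480, 144320, 41048, 123984, 41336, 68648, 83576, 408368, 148040, 304992, 137016] i := by
  decide +kernel

theorem injective_pairInvariant_qlr : Function.Injective fun i => (qlr i).pairInvariant := by
  simp only [pairInvariant_qlr]
  decide +kernel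

theorem not_equivalent_qlr {i j : Fin 7 ⊕ Fin 24} (hij : i ≠ j) :
    ¬ (qlr i).Equivalent (qlr j) := fun h =>
  hij <| injective_pairInvariant_qlr <| Eq.symm <|
    h.pairInvariant_eq (exists_natAbs_qlr_eq_one i) (exists_natAbs_qlr_eq_one j)

theorem exists_isContractionMap_qlr {i : Fin 7 ⊕ Fin 24} (hi : i ∈ proven) :
    ∃ f, ∀ k, (qlr i).IsContractionMap k f :=
  (isCertificate_truthTables i hi).exists_isContractionMap

end EntropyIneq

theorem mainTheorem7 :
    (∀ i j, i ≠ j → ¬ (EntropyIneq.qlr i).Equivalent (EntropyIneq.qlr j)) ∧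
    EntropyIneq.proven.card = 14 ∧
    ∀ i ∈ EntropyIneq.proven,
      (∃ f, ∀ k, 2 ≤ k → (EntropyIneq.qlr i).IsContractionMap k f) ∧
      ∀ (V : Type u) (H : ColoredHypergraph 5 V), H.FiniteRank →
        (EntropyIneq.qlr i).HoldsOn H := by
  refine ⟨fun i j => EntropyIneq.not_equivalent_qlr, by decide, fun i hi => ?_⟩
  obtain ⟨f, hf⟩ := EntropyIneq.exists_isContractionMap_qlr hi
  exact ⟨⟨f, fun k _ => hf k⟩, fun V H hH =>
    EntropyIneq.holdsOn_of_isContractionMap (fun k _ => hf k) H hH⟩
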